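/- **Setting.** Let $N\ge 1$, let $\Omega\subset\mathbb R^N$ be a bounded open set (for example, a bounded Lipschitz domain), $0<T<\infty$, $Q_T=\Omega\times(0,T)$, let $\omega\subset\Omega$ be open, and $q_T=\omega\times(0,T)$. Let $H^1_0(\Omega)$ be the closure of $C_c^\infty(\Omega)$ in $H^1(\Omega)$, equipped with the inner product $(v,w)_{H^1_0(\Omega)}=(\nabla v,\nabla w)_{L^2(\Omega)}$. Put $$Y=\{y\in C([0,T];H^1_0(\Omega)) : \partial_t y\in C([0,T];L^2(\Omega)),\ \partial_{tt}y-\Delta y\in L^2(Q_T)\},$$ $U=L^2(Q_T)$, $R_1=H^1_0(\Omega)$, $R_2=L^2(\Omega)$, and define $K=(K_U,K_{R_1},K_{R_2})$ on $Y$ by $$K_Uy=(\partial_{tt}y-\Delta y,\cdot)_{L^2(Q_T)}\in U',\quad K_{R_1}y=(y(0),\cdot)_{H^1_0(\Omega)}\in R_1',\quad K_{R_2}y=(\partial_ty(0),\cdot)_{L^2(\Omega)}\in R_2'.$$ For a norm (or seminorm) $\|\cdot\|_Y$ on $Y$ and $c_K>0$, condition (K1) with constant $c_K$ says $$\|y\|_Y\le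 c_K\sqrt{\|K_Uy\|_{U'}^2+\|K_{R_1}y\|_{R_1'}^2+\|K_{R_2}y\|_{R_2'}^2}\qquad\text{for all } y\in Y.$$ Let $Y_h\subset Y$, $U_h\subset U$, $R_{1,h}\subset R_1$, $R_{2,h}\subset R_2$ be finite-dimensional subspaces. Let $K_{U_h}:Y_h\to U_h'$, $K_{R_{i,h}}:Y_h\to R_{i,h}'$ be the restrictions $\langle K_{U_h}y_h,u_h\rangle=\langle K_Uy_h,u_h\rangle$, $\langle K_{R_{i,h}}y_h,r_h\rangle=\langle K_{R_i}y_h,r_h\rangle$, with transposes $K_{U_h}':U_h\to Y_h'$, $K_{R_{i,h}}':R_{i,h}\to Y_h'$, and let $\mathcal I_X:X\to X'$, $\langle\mathcal I_Xx,x'\rangle=(x,x')_X$. Condition (K1) for the discrete operator $K_h=(K_{U_h},K_{R_{1,h}},K_{R_{2,h}})$ is the inequality above for all $y\in Y_h$, with $K_U,K_{R_i},U',R_i'$ replaced by $K_{U_h},K_{R_{i,h}},U_h',R_{i,h}'$ and with $\|\cdot\|_Y$ restricted to $Y_h$. For $\alpha>0$ define $P_{Y_h},\widetilde P_{Y_h}:Y_h\to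 Y_h'$ by $$\langle P_{Y_h}y,z\rangle=(y,z)_{L^2(q_T)}+\alpha(\partial_{tt}y-\Delta y,\partial_{tt}z-\Delta z)_{L^2(Q_T)}+(\nabla y(0),\nabla z(0))_{L^2(\Omega)}+(\partial_ty(0),\partial_tz(0))_{L^2(\Omega)},$$ $$\langle\widetilde P_{Y_h}y,z\rangle=(y,z)_{L^2(q_T)}+\alpha\langle K_{U_h}'\mathcal I_{U_h}^{-1}K_{U_h}y,z\rangle+\sum_{i=1}^2\langle K_{R_{i,h}}'\mathcal I_{R_{i,h}}^{-1}K_{R_{i,h}}y,z\rangle .$$ **Lemma 5.1.** Assume $Y_h=Y_h^t\otimes Y_h^x$ (the linear span of the functions $(x,t)\mapsto\theta(t)v(x)$ with $\theta\in Y_h^t$, $v\in Y_h^x$), where $Y_h^t$ is a linear space of real functions on $[0,T]$ and $Y_h^x\subset H^1_0(\Omega)$ is a linear subspace. If $$(\partial_{tt}-\Delta)Y_h\subset U_h,\qquad Y_h^x\subset R_{1,h},\qquad Y_h^x\subset R_{2,h},$$ then: 1. For every $\alpha>0$, $\widetilde P_{Y_h}=P_{Y_h}$, both as operators $Y_h\to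 Y_h'$ and as matrices relative to arbitrary bases of $Y_h,U_h,R_{1,h},R_{2,h}$. In the matrix version, $\widetilde P_{Y_h}=M_{q_T,h}+\alpha K_{U_h}^TM_{U_h}^{-1}K_{U_h}+\sum_{i=1}^2K_{R_{i,h}}^TM_{R_{i,h}}^{-1}K_{R_{i,h}}$, where $M_{q_T,h}$ is the matrix of $(\cdot,\cdot)_{L^2(q_T)}$ on $Y_h$, the $K$'s are the matrices of the operators above, and $M_X$ is the Gram matrix of the basis of $X$. 2. For every norm (or seminorm) $\|\cdot\|_Y$ on $Y$ and every $c_K>0$: if (K1) holds for $K$ with constant $c_K$, then (K1) holds for $K_h$ with the same constant $c_K$. In particular, for the canonical norm $$\|y\|_Y=\bigl(\|\partial_{tt}y-\Delta y\|^2_{L^2(Q_T)}+\|y(0)\|^2_{H^1_0(\Omega)}+\|\partial_ty(0)\|^2_{L^2(\Omega)}\bigr)^{1/2},$$ (K1) holds for both $K$ and $K_h$ with $c_K=1$. -/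

import Mathlib

open MeasureTheory Set Filter Topology
open scoped ContDiff InnerProductSpace

noncomputable section

namespace WaveControl

/-! ### The space-time cylinder and test functions -/

/-- Geometric data: a bounded open set `Ω ⊆ ℝᴺ`, `N ≥ 1`, and a finite final time `T > 0`. -/
structure Cylinder (N : ℕ) where
  /-- the spatial set `Ω` -/
  Ω : Set (EuclideanSpace ℝ (Fin N))
  isOpen : IsOpen Ω
  isBounded : Bornology.IsBounded Ω
  dim_pos : 0 < N
  /-- the final time -/
  T : ℝ
  T_pos : 0 < T

variable {N : ℕ}

/-- The space-time cylinder `Q_T = Ω × (0,T)`. -/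
def Cylinder.QT (Q : Cylinder N) : Set (EuclideanSpace ℝ (Fin N) × ℝ) := Q.Ω ×ˢ Ioo 0 Q.T

/-- `φ ∈ C_c^∞(U)`. -/
structure IsTestFunction {E : Type*} [NormedAddCommGroup E] [NormedSpace ℝ E]
    (U : Set E) (φ : E → ℝ) : Prop where
  contDiff : ContDiff ℝ ∞ φ
  hasCompactSupport : HasCompactSupport φ
  tsupport_subset : tsupport φ ⊆ U

/-- `L²(Ω)`. -/
abbrev L2Ω (Q : Cylinder N) : Type := Lp ℝ 2 (volume.restrict Q.Ω)

/-- `L²(Ω; ℝᴺ)`. -/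
abbrev L2ΩVec (Q : Cylinder N) : Type :=
  Lp (EuclideanSpace ℝ (Fin N)) 2 (volume.restrict Q.Ω)

/-- `L²(Q_T)`. -/
abbrev L2QT (Q : Cylinder N) : Type := Lp ℝ 2 (volume.restrict Q.QT)

instance (Q : Cylinder N) : IsFiniteMeasure (volume.restrict Q.Ω) :=
  ⟨by simpa using Q.isBounded.measure_lt_top⟩

/-! ### The space `H¹₀(Ω)` with inner product `(∇v, ∇w)_{L²(Ω)}` -/

/-- The pairs `(φ, ∇φ)` with `φ ∈ C_c^∞(Ω)`. -/
def testGraph (Q : Cylinder N) : Submodule ℝ (L2Ω Q × L2ΩVec Q) where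
  carrier := {p | ∃ φ : EuclideanSpace ℝ (Fin N) → ℝ, IsTestFunction Q.Ω φ ∧
    (p.1 =ᵐ[volume.restrict Q.Ω] φ) ∧
    (p.2 =ᵐ[volume.restrict Q.Ω] fun x => gradient φ x)}
  zero_mem' := by
    refine ⟨fun _ => 0, ⟨contDiff_const, HasCompactSupport.zero, ?_⟩, ?_, ?_⟩
    · simp [tsupport]
    · exact Lp.coeFn_zero _ _ _
    · refine (Lp.coeFn_zero _ _ _).trans (Eventually.of_forall fun x => ?_)
      simp [gradient]
  add_mem' := by
    rintro p q ⟨φ, hφ, h1, h2⟩ ⟨ψ, hψ, k1, k2⟩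
    refine ⟨φ + ψ, ⟨hφ.contDiff.add hψ.contDiff, hφ.hasCompactSupport.add hψ.hasCompactSupport,
      (tsupport_add φ ψ).trans (union_subset hφ.tsupport_subset hψ.tsupport_subset)⟩, ?_, ?_⟩
    · exact (Lp.coeFn_add _ _).trans (h1.add k1)
    · refine (Lp.coeFn_add _ _).trans ((h2.add k2).trans (Eventually.of_forall fun x => ?_))
      have d1 : DifferentiableAt ℝ φ x := (hφ.contDiff.differentiable (by simp)) x
      have d2 : DifferentiableAt ℝ ψ x := (hψ.contDiff.differentiable (by simp)) x
      simp [gradient, fderiv_add d1 d2]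
  smul_mem' := by
    rintro c p ⟨φ, hφ, h1, h2⟩
    refine ⟨c • φ, ⟨hφ.contDiff.const_smul c, hφ.hasCompactSupport.smul_left (f := fun _ => c),
      (tsupport_smul_subset_right (fun _ => c) φ).trans hφ.tsupport_subset⟩, ?_, ?_⟩
    · exact (Lp.coeFn_smul _ _).trans (h1.const_smul c)
    · refine (Lp.coeFn_smul _ _).trans ((h2.const_smul c).trans (Eventually.of_forall fun x => ?_))
      have d1 : DifferentiableAt ℝ φ x := (hφ.contDiff.differentiable (by simp)) x
      simp [gradient, fderiv_const_smul d1 c]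

/-- The space `H¹₀(Ω)`: the closure of `C_c^∞(Ω)` in `H¹(Ω)`. A Sobolev function `v` is stored
together with its weak gradient as the pair `(v, ∇v)` in `L²(Ω) × L²(Ω; ℝᴺ)`, so that the
`H¹`-closure becomes the closure of the pairs `(φ, ∇φ)`. -/
def H10 (Q : Cylinder N) : Type := ↥(testGraph Q).topologicalClosure

namespace H10

variable {Q : Cylinder N}

instance : AddCommGroup (H10 Q) :=
  inferInstanceAs (AddCommGroup ↥(testGraph Q).topologicalClosure)

instance : Module ℝ (H10 Q) :=
  inferInstanceAs (Module ℝ ↥(testGraph Q).topologicalClosure)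

/-- The embedding `H¹₀(Ω) → L²(Ω)`. -/
def toL2 : H10 Q →ₗ[ℝ] L2Ω Q :=
  (LinearMap.fst ℝ (L2Ω Q) (L2ΩVec Q)).comp (testGraph Q).topologicalClosure.subtype

/-- The gradient `∇ : H¹₀(Ω) → L²(Ω; ℝᴺ)`. -/
def grad : H10 Q →ₗ[ℝ] L2ΩVec Q :=
  (LinearMap.snd ℝ (L2Ω Q) (L2ΩVec Q)).comp (testGraph Q).topologicalClosure.subtype

theorem ext_pair {v w : H10 Q} (h1 : toL2 v = toL2 w) (h2 : grad v = grad w) : v = w :=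
  Subtype.ext (Prod.ext h1 h2)

/-- Poincaré's inequality for test functions. -/
theorem poincare_test {R : ℝ} (hR0 : 0 ≤ R) (hR : ∀ x ∈ Q.Ω, ‖x‖ ≤ R) {p : L2Ω Q × L2ΩVec Q}
    (hp : p ∈ testGraph Q) : ‖p.1‖ ≤ 2 * R * ‖p.2‖ := by
  obtain ⟨φ, hφ, h1, h2⟩ := hp
  have hd : Differentiable ℝ φ := hφ.contDiff.differentiable (by simp)
  have hcont : Continuous φ := hφ.contDiff.continuous
  have hcs := hφ.hasCompactSupport
  have hfc : Continuous (fderiv ℝ φ) := hφ.contDiff.continuous_fderiv (by simp)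
  let i : Fin N := ⟨0, Q.dim_pos⟩
  let e : EuclideanSpace ℝ (Fin N) := EuclideanSpace.single i 1
  let ℓ : EuclideanSpace ℝ (Fin N) →L[ℝ] ℝ := EuclideanSpace.proj i
  have hℓe : ℓ e = 1 := by simp [ℓ, e]
  have hne : ‖e‖ = 1 := by simp [e]
  have hsq : ∀ x, fderiv ℝ (fun x => φ x * φ x) x e = 2 * φ x * fderiv ℝ φ x e := by
    intro x
    have := ((hd x).hasFDerivAt.mul (hd x).hasFDerivAt).fderiv
    rw [show (fun x => φ x * φ x) = φ * φ from rfl, this]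
    simp; ring
  have key : ∫ x, φ x * φ x = - ∫ x, 2 * φ x * fderiv ℝ φ x e * ℓ x := by
    have := integral_mul_fderiv_eq_neg_fderiv_mul_of_integrable (μ := volume)
      (f := fun x => φ x * φ x) (g := fun x => ℓ x) (v := e) ?_ ?_ ?_
      (fun x _ => (hd x).mul (hd x)) (fun x _ => ℓ.differentiableAt)
    · simpa [hsq, hℓe] using this
    · simp only [hsq]
      refine Continuous.integrable_of_hasCompactSupport (by fun_prop) ?_
      exact ((hcs.mul_left (f := fun _ => (2 : ℝ))).mul_right).mul_right
    · refine Continuous.integrable_of_hasCompactSupport (by simp [hℓe]; fun_prop) ?_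
      exact (hcs.mul_right).mul_right
    · refine Continuous.integrable_of_hasCompactSupport (by fun_prop) ?_
      exact (hcs.mul_right).mul_right
  have hzero : ∀ x, x ∉ Q.Ω → φ x = 0 := fun x hx =>
    image_eq_zero_of_notMem_tsupport fun h => hx (hφ.tsupport_subset h)
  -- both sides as integrals over `Ω`
  have hL : ‖p.1‖ ^ 2 = ∫ x, φ x * φ x := by
    rw [← real_inner_self_eq_norm_sq, L2.inner_def,
      ← setIntegral_eq_integral_of_forall_compl_eq_zero (s := Q.Ω)
        (f := fun x => φ x * φ x) (fun x hx => by simp [hzero x hx])]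
    refine integral_congr_ae ?_
    filter_upwards [h1] with x hx
    simp [hx, sq]
  let a : L2Ω Q := (Lp.memLp p.1).norm.toLp _
  let b : L2Ω Q := (Lp.memLp p.2).norm.toLp _
  have ha : ‖a‖ = ‖p.1‖ := by
    rw [Lp.norm_toLp, eLpNorm_norm, Lp.norm_def]
  have hb : ‖b‖ = ‖p.2‖ := by
    rw [Lp.norm_toLp, eLpNorm_norm, Lp.norm_def]
  have hab : ∫ x, φ x * φ x ≤ 2 * R * inner ℝ a b := by
    rw [key, ← integral_neg, ← setIntegral_eq_integral_of_forall_compl_eq_zero (s := Q.Ω)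
        (fun x hx => by simp [hzero x hx]), L2.inner_def, ← integral_const_mul]
    have hint : Integrable (fun x => 2 * R * inner ℝ (a x) (b x)) (volume.restrict Q.Ω) :=
      (L2.integrable_inner a b).const_mul _
    refine integral_mono_ae ?_ hint ?_
    · refine Integrable.neg (Integrable.integrableOn ?_)
      refine Continuous.integrable_of_hasCompactSupport (by fun_prop) ?_
      exact ((hcs.mul_left (f := fun _ => (2 : ℝ))).mul_right).mul_right
    · filter_upwards [h1, h2, (Lp.memLp p.1).norm.coeFn_toLp, (Lp.memLp p.2).norm.coeFn_toLp,
        ae_restrict_mem Q.isOpen.measurableSet] with x hx1 hx2 hxa hxb hxΩ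
      have e1 : a x = |φ x| := by rw [← Real.norm_eq_abs, ← hx1]; exact hxa
      have e2 : b x = ‖fderiv ℝ φ x‖ := by simp [b, hxb, hx2, gradient]
      have e3 : |fderiv ℝ φ x e| ≤ ‖fderiv ℝ φ x‖ := by
        simpa [hne] using (fderiv ℝ φ x).le_opNorm e
      have e4 : |ℓ x| ≤ R := by
        have : ‖x i‖ ≤ ‖x‖ := PiLp.norm_apply_le x i
        exact this.trans (hR x hxΩ)
      simp only [e1, e2, RCLike.inner_apply, conj_trivial]
      calc -(2 * φ x * fderiv ℝ φ x e * ℓ x) ≤ |2 * φ x * fderiv ℝ φ x e * ℓ x| := neg_le_abs _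
        _ = 2 * |φ x| * |fderiv ℝ φ x e| * |ℓ x| := by simp [abs_mul]
        _ ≤ 2 * |φ x| * ‖fderiv ℝ φ x‖ * R := by gcongr
        _ = _ := by ring
  have hfin : ‖p.1‖ ^ 2 ≤ 2 * R * (‖p.1‖ * ‖p.2‖) := by
    rw [hL]
    refine hab.trans ?_
    have := real_inner_le_norm a b
    rw [ha, hb] at this
    gcongr
  rcases (norm_nonneg p.1).eq_or_lt with h | h
  · rw [← h]; positivity
  · nlinarith

/-- Poincaré's inequality on `H¹₀(Ω)`. -/
theorem poincare (Q : Cylinder N) : ∃ C : ℝ, ∀ v : H10 Q, ‖toL2 v‖ ≤ C * ‖grad v‖ := by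
  obtain ⟨R, hR0, hR⟩ := Q.isBounded.exists_pos_norm_le
  refine ⟨2 * R, fun v => ?_⟩
  have hcl : IsClosed {p : L2Ω Q × L2ΩVec Q | ‖p.1‖ ≤ 2 * R * ‖p.2‖} :=
    isClosed_le (by fun_prop) (by fun_prop)
  exact closure_minimal (fun p hp => poincare_test hR0.le hR hp) hcl v.2

/-- The inner product `(∇v, ∇w)_{L²(Ω)}` on `H¹₀(Ω)`. -/
@[reducible] def core (Q : Cylinder N) : InnerProductSpace.Core ℝ (H10 Q) where
  inner v w := inner ℝ (grad v) (grad w)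
  conj_inner_symm v w := by simp [real_inner_comm]
  re_inner_nonneg v := by simp
  add_left u v w := by simp [inner_add_left]
  smul_left v w r := by simp [real_inner_smul_left]
  definite v h := by
    have hg : grad v = 0 := inner_self_eq_zero.1 h
    obtain ⟨C, hC⟩ := poincare Q
    have h2 : toL2 v = 0 := by
      have := hC v
      rw [hg] at this
      simpa using this
    exact ext_pair (by rw [h2, map_zero]) (by rw [hg, map_zero])

instance : NormedAddCommGroup (H10 Q) := (core Q).toNormedAddCommGroup

instance : InnerProductSpace ℝ (H10 Q) := InnerProductSpace.ofCore (core Q).toCore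

theorem inner_def (v w : H10 Q) : inner ℝ v w = inner ℝ (grad v) (grad w) := rfl

theorem norm_def (v : H10 Q) : ‖v‖ = ‖grad v‖ := by
  rw [norm_eq_sqrt_real_inner, inner_def, ← norm_eq_sqrt_real_inner]

theorem continuous_toL2 : Continuous (toL2 : H10 Q →ₗ[ℝ] L2Ω Q) := by
  obtain ⟨C, hC⟩ := poincare Q
  exact AddMonoidHomClass.continuous_of_bound _ C fun v => by rw [norm_def]; exact hC v

end H10

/-! ### The state space `Y` -/

/-- `(∂_tt − Δ)Φ` at `z = (x,t)` for a smooth `Φ` on space-time. -/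
def waveTest (Φ : EuclideanSpace ℝ (Fin N) × ℝ → ℝ) (z : EuclideanSpace ℝ (Fin N) × ℝ) : ℝ :=
  iteratedFDeriv ℝ 2 Φ z ![(0, 1), (0, 1)] -
    ∑ i : Fin N, iteratedFDeriv ℝ 2 Φ z
      ![(EuclideanSpace.single i 1, 0), (EuclideanSpace.single i 1, 0)]

theorem continuous_waveTest {Φ : EuclideanSpace ℝ (Fin N) × ℝ → ℝ} (h : ContDiff ℝ ∞ Φ) :
    Continuous (waveTest Φ) := by
  have : Continuous (iteratedFDeriv ℝ 2 Φ) :=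
    h.continuous_iteratedFDeriv (m := 2) (WithTop.coe_le_coe.2 le_top)
  unfold waveTest
  fun_prop

theorem hasCompactSupport_waveTest {Φ : EuclideanSpace ℝ (Fin N) × ℝ → ℝ}
    (h : HasCompactSupport Φ) : HasCompactSupport (waveTest Φ) := by
  refine (h.iteratedFDeriv (𝕜 := ℝ) 2).mono fun z hz => ?_
  contrapose! hz
  simp only [Function.mem_support, not_not] at hz ⊢
  simp [waveTest, hz]

/-- Time extension of a function on `[0,T]` to `ℝ` (constant outside `[0,T]`); only its values on
`[0,T]` are ever used. -/
def Cylinder.ext (Q : Cylinder N) {X : Type*} (y : Icc (0 : ℝ) Q.T → X) : ℝ → X :=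
  IccExtend Q.T_pos.le y

/-- For `v ∈ C(ℝ; L²(Ω))` and `Ψ ∈ C_c(ℝᴺ × ℝ)`, the function `t ↦ ∫_Ω v(t) Ψ(·,t) dx` is
continuous. -/
theorem continuous_pairing (Q : Cylinder N) {v : ℝ → L2Ω Q} (hv : Continuous v)
    {Ψ : EuclideanSpace ℝ (Fin N) × ℝ → ℝ} (hΨ : Continuous Ψ) (hc : HasCompactSupport Ψ) :
    Continuous fun t => ∫ x in Q.Ω, v t x * Ψ (x, t) := by
  obtain ⟨B, hB⟩ := hc.exists_bound_of_continuous hΨ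
  have hmem : ∀ t, MemLp (fun x => Ψ (x, t)) 2 (volume.restrict Q.Ω) := fun t =>
    MemLp.of_bound (by fun_prop) B (Eventually.of_forall fun x => hB _)
  let w : ℝ → L2Ω Q := fun t => (hmem t).toLp _
  have hw : Continuous w := by
    have huc := hc.uniformContinuous_of_continuous hΨ
    rw [Metric.continuous_iff]
    intro t ε hε
    obtain ⟨m, hm'⟩ : ∃ m : ℝ, m =
      (measureUnivNNReal (volume.restrict Q.Ω) : ℝ) ^ ((2 : ENNReal).toReal⁻¹) := ⟨_, rfl⟩
    have hm0 : 0 ≤ m := by rw [hm']; positivity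
    obtain ⟨δ, hδ, h⟩ := Metric.uniformContinuous_iff.1 huc (ε / (m + 1)) (by positivity)
    refine ⟨δ, hδ, fun s hs => ?_⟩
    have hb : ∀ᵐ x ∂(volume.restrict Q.Ω), ‖(w s - w t) x‖ ≤ ε / (m + 1) := by
      filter_upwards [Lp.coeFn_sub (w s) (w t), (hmem s).coeFn_toLp, (hmem t).coeFn_toLp]
        with x h1 h2 h3
      rw [h1, Pi.sub_apply, h2, h3, ← dist_eq_norm]
      exact (h (by simpa [Prod.dist_eq] using hs)).le
    rw [dist_eq_norm]
    refine (Lp.norm_le_of_ae_bound (by positivity) hb).trans_lt ?_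
    rw [← hm', mul_div_assoc', div_lt_iff₀ (by positivity)]
    nlinarith
  refine (hv.inner (𝕜 := ℝ) hw).congr fun t => ?_
  rw [L2.inner_def]
  refine integral_congr_ae ?_
  filter_upwards [(hmem t).coeFn_toLp] with x hx
  simp [w, hx, mul_comm]

theorem integrable_pairing (Q : Cylinder N) (v : L2Ω Q)
    {Ψ : EuclideanSpace ℝ (Fin N) × ℝ → ℝ} (hΨ : Continuous Ψ) (hc : HasCompactSupport Ψ) (t : ℝ) :
    Integrable (fun x => v x * Ψ (x, t)) (volume.restrict Q.Ω) := by
  obtain ⟨B, hB⟩ := hc.exists_bound_of_continuous hΨ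
  exact ((Lp.memLp v).integrable (by norm_num)).mul_bdd (c := B) (by fun_prop)
    (Eventually.of_forall fun x => hB _)

theorem pairing_add (Q : Cylinder N) {u v : ℝ → L2Ω Q} (hu : Continuous u) (hv : Continuous v)
    {Ψ : EuclideanSpace ℝ (Fin N) × ℝ → ℝ} (hΨ : Continuous Ψ) (hc : HasCompactSupport Ψ) :
    ∫ t in Ioo 0 Q.T, ∫ x in Q.Ω, (u t + v t : L2Ω Q) x * Ψ (x, t) =
      (∫ t in Ioo 0 Q.T, ∫ x in Q.Ω, u t x * Ψ (x, t)) +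
        ∫ t in Ioo 0 Q.T, ∫ x in Q.Ω, v t x * Ψ (x, t) := by
  have hi : ∀ w : ℝ → L2Ω Q, Continuous w →
      IntegrableOn (fun t => ∫ x in Q.Ω, w t x * Ψ (x, t)) (Ioo 0 Q.T) := fun w hw =>
    ((continuous_pairing Q hw hΨ hc).integrableOn_Icc).mono_set Ioo_subset_Icc_self
  rw [← integral_add (hi u hu) (hi v hv)]
  congr 1
  funext t
  rw [← integral_add (integrable_pairing Q _ hΨ hc t) (integrable_pairing Q _ hΨ hc t)]
  refine integral_congr_ae ?_
  filter_upwards [Lp.coeFn_add (u t) (v t)] with x hx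
  rw [hx, Pi.add_apply, add_mul]

theorem pairing_smul (Q : Cylinder N) (c : ℝ) (u : ℝ → L2Ω Q)
    (Ψ : EuclideanSpace ℝ (Fin N) × ℝ → ℝ) :
    ∫ t in Ioo 0 Q.T, ∫ x in Q.Ω, (c • u t : L2Ω Q) x * Ψ (x, t) =
      c * ∫ t in Ioo 0 Q.T, ∫ x in Q.Ω, u t x * Ψ (x, t) := by
  rw [← integral_const_mul]
  congr 1
  funext t
  rw [← integral_const_mul]
  refine integral_congr_ae ?_
  filter_upwards [Lp.coeFn_smul c (u t)] with x hx
  rw [hx, Pi.smul_apply, smul_eq_mul, mul_assoc]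

theorem integrable_L2_mul (Q : Cylinder N) (f : L2QT Q)
    {Φ : EuclideanSpace ℝ (Fin N) × ℝ → ℝ} (hΦ : IsTestFunction Q.QT Φ) :
    Integrable (fun z => f z * Φ z) (volume.restrict Q.QT) :=
  (Lp.memLp f).integrable_mul (q := 2)
    (hΦ.contDiff.continuous.memLp_of_hasCompactSupport hΦ.hasCompactSupport)

/-- The state space
`Y = {y ∈ C([0,T]; H¹₀(Ω)) : ∂_t y ∈ C([0,T]; L²(Ω)), ∂_tt y − Δy ∈ L²(Q_T)}`.
A state `y` is stored together with `y' = ∂_t y` and `f = ∂_tt y − Δy`, both of which are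
uniquely determined by `y`; the second condition is `∂_tt y − Δy = f` in the sense of
distributions on `Q_T`. -/
def Y (Q : Cylinder N) :
    Submodule ℝ (C(Icc (0 : ℝ) Q.T, H10 Q) × C(Icc (0 : ℝ) Q.T, L2Ω Q) × L2QT Q) where
  carrier := {p |
    (∀ t : Icc (0 : ℝ) Q.T,
      HasDerivWithinAt (fun s : ℝ => H10.toL2 (Q.ext p.1 s)) (p.2.1 t) (Icc 0 Q.T) t) ∧
    ∀ Φ : EuclideanSpace ℝ (Fin N) × ℝ → ℝ, IsTestFunction Q.QT Φ →
      ∫ t in Ioo 0 Q.T, ∫ x in Q.Ω, H10.toL2 (Q.ext p.1 t) x * waveTest Φ (x, t) =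
        ∫ z in Q.QT, p.2.2 z * Φ z}
  zero_mem' := by
    have h0 : ∀ s, Q.ext (⇑(0 : C(Icc (0 : ℝ) Q.T, H10 Q))) s = 0 := fun s => rfl
    refine ⟨fun t => ?_, fun Φ hΦ => ?_⟩
    · simp only [Prod.fst_zero, h0, map_zero]
      exact hasDerivWithinAt_const _ _ _
    · have h1 := pairing_smul Q 0 (fun _ => 0) (waveTest Φ)
      simp only [smul_zero, zero_mul] at h1
      simp only [Prod.fst_zero, h0, map_zero, h1, Prod.snd_zero]
      symm
      refine integral_eq_zero_of_ae ?_
      filter_upwards [Lp.coeFn_zero ℝ 2 (volume.restrict Q.QT)] with z hz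
      rw [hz]; simp
  add_mem' := by
    rintro p q ⟨hp, hp'⟩ ⟨hq, hq'⟩
    have h0 : ∀ s, Q.ext (⇑(p + q).1) s = Q.ext p.1 s + Q.ext q.1 s := fun s => rfl
    refine ⟨fun t => ?_, fun Φ hΦ => ?_⟩
    · simp only [h0, map_add]
      exact (hp t).add (hq t)
    · have hcont : ∀ y : C(Icc (0 : ℝ) Q.T, H10 Q),
          Continuous fun t => H10.toL2 (Q.ext y t) := fun y =>
        H10.continuous_toL2.comp y.continuous.Icc_extend'
      simp only [h0, map_add]
      rw [pairing_add Q (hcont p.1) (hcont q.1) (continuous_waveTest hΦ.contDiff)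
        (hasCompactSupport_waveTest hΦ.hasCompactSupport), hp' Φ hΦ, hq' Φ hΦ,
        ← integral_add (integrable_L2_mul Q _ hΦ) (integrable_L2_mul Q _ hΦ)]
      refine integral_congr_ae ?_
      filter_upwards [Lp.coeFn_add p.2.2 q.2.2] with z hz
      simp only [Prod.snd_add, hz, Pi.add_apply, add_mul]
  smul_mem' := by
    rintro c p ⟨hp, hp'⟩
    have h0 : ∀ s, Q.ext (⇑(c • p).1) s = c • Q.ext p.1 s := fun s => rfl
    refine ⟨fun t => ?_, fun Φ hΦ => ?_⟩
    · simp only [h0, map_smul]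
      exact (hp t).const_smul c
    · simp only [h0, map_smul]
      rw [pairing_smul, hp' Φ hΦ, ← integral_const_mul]
      refine integral_congr_ae ?_
      filter_upwards [Lp.coeFn_smul c p.2.2] with z hz
      simp only [Prod.smul_snd, hz, Pi.smul_apply, smul_eq_mul, mul_assoc]

namespace Y

variable {Q : Cylinder N}

/-- The state `y` as a function `[0,T] → H¹₀(Ω)`. -/
def toFun : Y Q →ₗ[ℝ] (Icc (0 : ℝ) Q.T → H10 Q) where
  toFun y := ⇑y.1.1
  map_add' _ _ := rfl
  map_smul' _ _ := rfl

/-- The initial value `y(0) ∈ H¹₀(Ω)`. -/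
def init : Y Q →ₗ[ℝ] H10 Q where
  toFun y := y.1.1 ⟨0, le_rfl, Q.T_pos.le⟩
  map_add' _ _ := rfl
  map_smul' _ _ := rfl

/-- The initial velocity `∂_t y(0) ∈ L²(Ω)`. -/
def dtInit : Y Q →ₗ[ℝ] L2Ω Q where
  toFun y := y.1.2.1 ⟨0, le_rfl, Q.T_pos.le⟩
  map_add' _ _ := rfl
  map_smul' _ _ := rfl

/-- The wave operator `y ↦ ∂_tt y − Δy ∈ L²(Q_T)`. -/
def wave : Y Q →ₗ[ℝ] L2QT Q where
  toFun y := y.1.2.2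
  map_add' _ _ := rfl
  map_smul' _ _ := rfl

/-- A state is determined by its function `[0,T] → H¹₀(Ω)`: the stored `∂_t y` and `∂_tt y − Δy`
carry no additional information. -/
theorem toFun_injective : Function.Injective (toFun : Y Q →ₗ[ℝ] (Icc (0 : ℝ) Q.T → H10 Q)) := by
  rw [← LinearMap.ker_eq_bot, LinearMap.ker_eq_bot']
  rintro ⟨⟨y, y', f⟩, h1, h2⟩ h
  have hy : y = 0 := DFunLike.coe_injective h
  subst hy
  have h0 : ∀ s, Q.ext (⇑(0 : C(Icc (0 : ℝ) Q.T, H10 Q))) s = 0 := fun s => rfl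
  have hy' : y' = 0 := by
    ext1 t
    have := h1 t
    simp only [h0, map_zero] at this
    exact (uniqueDiffOn_Icc Q.T_pos _ t.2).eq_deriv _ this (hasDerivWithinAt_const _ _ _)
  have hf : f = 0 := by
    have hopen : IsOpen Q.QT := Q.isOpen.prod isOpen_Ioo
    have hbd : volume Q.QT < ⊤ := (Q.isBounded.prod (Metric.isBounded_Ioo 0 Q.T)).measure_lt_top
    have : IsFiniteMeasure (volume.restrict Q.QT) := ⟨by simpa using hbd⟩
    have hloc : LocallyIntegrableOn f Q.QT volume :=
      (IntegrableOn.locallyIntegrableOn ((Lp.memLp f).integrable (by norm_num)))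
    apply Lp.ext
    have := hopen.ae_eq_zero_of_integral_contDiff_smul_eq_zero hloc fun g hg hgc hgs => by
      have hg' : IsTestFunction Q.QT g := ⟨hg, hgc, hgs⟩
      have e := h2 g hg'
      have z := pairing_smul Q 0 (fun _ => 0) (waveTest g)
      simp only [smul_zero, zero_mul] at z
      simp only [h0, map_zero, z] at e
      rw [← setIntegral_eq_integral_of_forall_compl_eq_zero (s := Q.QT), e]
      · exact integral_congr_ae (Eventually.of_forall fun z => by simp [mul_comm])
      · intro x hx
        have : g x = 0 := image_eq_zero_of_notMem_tsupport fun h => hx (hgs h)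
        simp [this]
    have h0 : f =ᵐ[volume.restrict Q.QT] fun _ => (0 : ℝ) :=
      (ae_restrict_iff' hopen.measurableSet).2 this
    exact h0.trans (Lp.coeFn_zero ℝ 2 (volume.restrict Q.QT)).symm
  subst hy' hf
  rfl

/-- The canonical norm of `Y`,
`‖y‖_Y = (‖∂_tt y − Δy‖²_{L²(Q_T)} + ‖y(0)‖²_{H¹₀(Ω)} + ‖∂_t y(0)‖²_{L²(Ω)})^{1/2}`,
see `canonicalNorm_apply`. -/
def canonicalNorm (Q : Cylinder N) : Seminorm ℝ (Y Q) :=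
  (normSeminorm ℝ (WithLp 2 (L2QT Q × WithLp 2 (H10 Q × L2Ω Q)))).comp
    ((WithLp.linearEquiv 2 ℝ (L2QT Q × WithLp 2 (H10 Q × L2Ω Q))).symm.toLinearMap.comp
      (wave.prod ((WithLp.linearEquiv 2 ℝ (H10 Q × L2Ω Q)).symm.toLinearMap.comp
        (init.prod dtInit))))

theorem canonicalNorm_apply (y : Y Q) :
    canonicalNorm Q y = √(‖wave y‖ ^ 2 + ‖init y‖ ^ 2 + ‖dtInit y‖ ^ 2) := by
  change ‖WithLp.toLp 2 (wave y, WithLp.toLp 2 (init y, dtInit y))‖ = _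
  rw [WithLp.prod_norm_eq_of_L2, WithLp.prod_norm_sq_eq_of_L2]
  simp [add_assoc]

end Y

/-! ### The state operator -/

section StateOperator

variable {Q : Cylinder N}

/-- `𝓘_X : X → X'`, `⟨𝓘_X x, y⟩ = (x, y)_X`, on a real inner product space. -/
def rieszMap (X : Type*) [NormedAddCommGroup X] [InnerProductSpace ℝ X] :
    X →ₗ[ℝ] StrongDual ℝ X where
  toFun x := innerSL ℝ x
  map_add' x y := by simp
  map_smul' c x := by simp

/-- `K_U y = (∂_tt y − Δy, ·)_{L²(Q_T)}`. -/
def KU (Q : Cylinder N) : Y Q →ₗ[ℝ] StrongDual ℝ (L2QT Q) := (rieszMap (L2QT Q)).comp Y.wave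

/-- `K_{R₁} y = (y(0), ·)_{H¹₀(Ω)}`. -/
def KR1 (Q : Cylinder N) : Y Q →ₗ[ℝ] StrongDual ℝ (H10 Q) := (rieszMap (H10 Q)).comp Y.init

/-- `K_{R₂} y = (∂_t y(0), ·)_{L²(Ω)}`. -/
def KR2 (Q : Cylinder N) : Y Q →ₗ[ℝ] StrongDual ℝ (L2Ω Q) := (rieszMap (L2Ω Q)).comp Y.dtInit

/-- Condition (K1) with constant `cK` for the state operator `K = (K_U, K_{R₁}, K_{R₂})` with
respect to a norm on `Y`: `‖y‖_Y ≤ cK ‖K y‖_{M'}` for all `y ∈ Y`. The norms on the right are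
dual norms. -/
def ConditionK1 (Q : Cylinder N) (normY : Seminorm ℝ (Y Q)) (cK : ℝ) : Prop :=
  0 < cK ∧ ∀ y : Y Q,
    normY y ≤ cK * √(‖KU Q y‖ ^ 2 + (‖KR1 Q y‖ ^ 2 + ‖KR2 Q y‖ ^ 2))

end StateOperator

/-! ### Conforming discretization -/

/-- Finite-dimensional conforming discretization spaces `Y_h ⊆ Y`, `U_h ⊆ L²(Q_T)`,
`R_{1,h} ⊆ H¹₀(Ω)`, `R_{2,h} ⊆ L²(Ω)`. -/
structure Discretization (Q : Cylinder N) where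
  Yh : Submodule ℝ (Y Q)
  Uh : Submodule ℝ (L2QT Q)
  R1h : Submodule ℝ (H10 Q)
  R2h : Submodule ℝ (L2Ω Q)
  finYh : FiniteDimensional ℝ Yh
  finUh : FiniteDimensional ℝ Uh
  finR1h : FiniteDimensional ℝ R1h
  finR2h : FiniteDimensional ℝ R2h

/-- The tensor product of a space `Yt` of functions on `[0,T]` and a space `Yx ⊆ H¹₀(Ω)`,
realized as the span of the functions `t ↦ θ(t) v` with `θ ∈ Yt`, `v ∈ Yx`. -/
def tensorSpace (Q : Cylinder N) (Yt : Submodule ℝ (Icc (0 : ℝ) Q.T → ℝ))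
    (Yx : Submodule ℝ (H10 Q)) : Submodule ℝ (Icc (0 : ℝ) Q.T → H10 Q) :=
  Submodule.span ℝ {w | ∃ θ ∈ Yt, ∃ v ∈ Yx, w = fun t => θ t • v}

/-- `⟨K' 𝓘_X⁻¹ K y, z⟩ = ⟨K z, 𝓘_X⁻¹ K y⟩` for a linear operator `K : V → X'` into the dual of a
Hilbert space `X`; here `K' : X → V'`, `⟨K' x, z⟩ = ⟨K z, x⟩`, is the transpose of `K`, and
`𝓘_X⁻¹ : X' → X` is the Riesz isomorphism. -/
def transposeRieszForm {V X : Type*} [AddCommMonoid V] [Module ℝ V] [NormedAddCommGroup X]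
    [InnerProductSpace ℝ X] [CompleteSpace X] (K : V →ₗ[ℝ] StrongDual ℝ X) (y z : V) : ℝ :=
  K z ((InnerProductSpace.toDual ℝ X).symm (K y))

/-- Galerkin restriction of `K : V → X'` to subspaces: `K_h : V_h → X_h'`,
`⟨K_h y, x⟩ = ⟨K y, x⟩` for `y ∈ V_h`, `x ∈ X_h`. -/
def galerkin {V X : Type*} [AddCommGroup V] [Module ℝ V] [NormedAddCommGroup X]
    [InnerProductSpace ℝ X] (K : V →ₗ[ℝ] StrongDual ℝ X) (Vh : Submodule ℝ V)
    (Xh : Submodule ℝ X) : Vh →ₗ[ℝ] StrongDual ℝ Xh where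
  toFun y := (K y).comp Xh.subtypeL
  map_add' y z := by ext; simp
  map_smul' c y := by ext; simp

/-- `(y, z)_{L²(q_T)} = ∫₀ᵀ ∫_{ω₀} y z dx dt`, where `q_T = ω₀ × (0,T)`. -/
def obsForm {Q : Cylinder N} (ω₀ : Set (EuclideanSpace ℝ (Fin N))) (y z : Y Q) : ℝ :=
  ∫ t in Ioo 0 Q.T, ∫ x in ω₀,
    H10.toL2 (Q.ext (Y.toFun y) t) x * H10.toL2 (Q.ext (Y.toFun z) t) x

/-- The matrix `(⟨K b_j, c_i⟩)_{i,j}` of an operator `K : V → X'` relative to bases. -/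
def operatorMatrix {V X ι κ : Type*} [AddCommMonoid V] [Module ℝ V] [NormedAddCommGroup X]
    [InnerProductSpace ℝ X] (K : V →ₗ[ℝ] StrongDual ℝ X) (b : Module.Basis ι ℝ V)
    (c : Module.Basis κ ℝ X) : Matrix κ ι ℝ :=
  Matrix.of fun i j => K (b j) (c i)

/-- The matrix `(B(b_j, b_i))_{i,j}` of a form `B` on `V` relative to a basis. -/
def formMatrix {V ι : Type*} [AddCommMonoid V] [Module ℝ V] (B : V → V → ℝ)
    (b : Module.Basis ι ℝ V) : Matrix ι ι ℝ :=
  Matrix.of fun i j => B (b j) (b i)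

namespace Discretization

variable {Q : Cylinder N} (D : Discretization Q)

instance : FiniteDimensional ℝ D.Yh := D.finYh
instance : FiniteDimensional ℝ D.Uh := D.finUh
instance : FiniteDimensional ℝ D.R1h := D.finR1h
instance : FiniteDimensional ℝ D.R2h := D.finR2h
instance : CompleteSpace D.Uh := FiniteDimensional.complete ℝ _
instance : CompleteSpace D.R1h := FiniteDimensional.complete ℝ _
instance : CompleteSpace D.R2h := FiniteDimensional.complete ℝ _

/-- `K_{U_h} : Y_h → U_h'`. -/
def KUh : D.Yh →ₗ[ℝ] StrongDual ℝ D.Uh := galerkin (KU Q) D.Yh D.Uh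

/-- `K_{R_{1,h}} : Y_h → R_{1,h}'`. -/
def KR1h : D.Yh →ₗ[ℝ] StrongDual ℝ D.R1h := galerkin (KR1 Q) D.Yh D.R1h

/-- `K_{R_{2,h}} : Y_h → R_{2,h}'`. -/
def KR2h : D.Yh →ₗ[ℝ] StrongDual ℝ D.R2h := galerkin (KR2 Q) D.Yh D.R2h

/-- Condition (K1) with constant `cK` for the discrete state operator
`K_h = (K_{U_h}, K_{R_{1,h}}, K_{R_{2,h}})`, where `Y_h` carries the norm of `Y`. -/
def ConditionK1 (normY : Seminorm ℝ (Y Q)) (cK : ℝ) : Prop :=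
  0 < cK ∧ ∀ y : D.Yh,
    normY (y : Y Q) ≤ cK * √(‖D.KUh y‖ ^ 2 + (‖D.KR1h y‖ ^ 2 + ‖D.KR2h y‖ ^ 2))

/-- The block `P_{Y_h}` of the sparse preconditioner, as the form `⟨P_{Y_h} y, z⟩` on `Y_h`. -/
def sparseBlock (ω₀ : Set (EuclideanSpace ℝ (Fin N))) (α : ℝ) (y z : D.Yh) : ℝ :=
  obsForm ω₀ (y : Y Q) z + α * inner ℝ (Y.wave (y : Y Q)) (Y.wave (z : Y Q))
    + inner ℝ (H10.grad (Y.init (y : Y Q))) (H10.grad (Y.init (z : Y Q)))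
    + inner ℝ (Y.dtInit (y : Y Q)) (Y.dtInit (z : Y Q))

/-- The block `P̃_{Y_h}` of the theoretical preconditioner, as the form
`⟨P̃_{Y_h} y, z⟩ = (y,z)_{L²(q_T)} + α ⟨K_{U_h}' 𝓘_{U_h}⁻¹ K_{U_h} y, z⟩
  + ⟨K_{R_{1,h}}' 𝓘_{R_{1,h}}⁻¹ K_{R_{1,h}} y, z⟩ + ⟨K_{R_{2,h}}' 𝓘_{R_{2,h}}⁻¹ K_{R_{2,h}} y, z⟩`. -/
def theoreticalBlock (ω₀ : Set (EuclideanSpace ℝ (Fin N))) (α : ℝ) (y z : D.Yh) : ℝ :=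
  obsForm ω₀ (y : Y Q) z + α * transposeRieszForm D.KUh y z
    + transposeRieszForm D.KR1h y z + transposeRieszForm D.KR2h y z

variable {ιY ιU ι1 ι2 : Type*} [Fintype ιU] [Fintype ι1] [Fintype ι2]
  [DecidableEq ιU] [DecidableEq ι1] [DecidableEq ι2]

/-- The matrix `P_{Y_h}` relative to a basis of `Y_h`. -/
def sparseMatrix (ω₀ : Set (EuclideanSpace ℝ (Fin N))) (α : ℝ) (bY : Module.Basis ιY ℝ D.Yh) :
    Matrix ιY ιY ℝ :=
  formMatrix (D.sparseBlock ω₀ α) bY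

/-- The matrix `P̃_{Y_h} = M_{q_T,h} + α K_{U_h}ᵀ M_{U_h}⁻¹ K_{U_h}
+ K_{R_{1,h}}ᵀ M_{R_{1,h}}⁻¹ K_{R_{1,h}} + K_{R_{2,h}}ᵀ M_{R_{2,h}}⁻¹ K_{R_{2,h}}` relative to bases
of the discretization spaces, `M_X` being the Gram matrix of the basis of `X`, that is, the matrix
of `𝓘_X`. -/
def theoreticalMatrix (ω₀ : Set (EuclideanSpace ℝ (Fin N))) (α : ℝ)
    (bY : Module.Basis ιY ℝ D.Yh) (bU : Module.Basis ιU ℝ D.Uh)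
    (b1 : Module.Basis ι1 ℝ D.R1h) (b2 : Module.Basis ι2 ℝ D.R2h) : Matrix ιY ιY ℝ :=
  formMatrix (fun y z : D.Yh => obsForm ω₀ (y : Y Q) z) bY
    + α • ((operatorMatrix D.KUh bY bU).transpose * (Matrix.gram ℝ bU)⁻¹
        * operatorMatrix D.KUh bY bU)
    + (operatorMatrix D.KR1h bY b1).transpose * (Matrix.gram ℝ b1)⁻¹
        * operatorMatrix D.KR1h bY b1
    + (operatorMatrix D.KR2h bY b2).transpose * (Matrix.gram ℝ b2)⁻¹
        * operatorMatrix D.KR2h bY b2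

end Discretization

end WaveControl

end

open WaveControl

namespace WaveControl

section Galerkin

variable {V X : Type*} [AddCommGroup V] [Module ℝ V] [NormedAddCommGroup X]
  [InnerProductSpace ℝ X]

theorem norm_rieszMap (x : X) : ‖rieszMap X x‖ = ‖x‖ :=
  innerSL_apply_norm ℝ x

/-- If `k y ∈ X_h`, then the Galerkin restriction of `y ↦ (k y, ·)` maps `y` to the Riesz
functional of `k y` on `X_h`. -/
theorem galerkin_rieszMap_comp (k : V →ₗ[ℝ] X) {Vh : Submodule ℝ V} {Xh : Submodule ℝ X}
    (y : Vh) (hy : k y ∈ Xh) :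
    galerkin ((rieszMap X).comp k) Vh Xh y = rieszMap Xh ⟨k y, hy⟩ := rfl

theorem norm_galerkin_rieszMap_comp (k : V →ₗ[ℝ] X) {Vh : Submodule ℝ V} {Xh : Submodule ℝ X}
    (y : Vh) (hy : k y ∈ Xh) :
    ‖galerkin ((rieszMap X).comp k) Vh Xh y‖ = ‖k y‖ := by
  rw [galerkin_rieszMap_comp k y hy, norm_rieszMap]
  rfl

theorem transposeRieszForm_galerkin (k : V →ₗ[ℝ] X) {Vh : Submodule ℝ V} {Xh : Submodule ℝ X}
    [CompleteSpace Xh] (hk : ∀ y : Vh, k y ∈ Xh) (y z : Vh) :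
    transposeRieszForm (galerkin ((rieszMap X).comp k) Vh Xh) y z = inner ℝ (k y) (k z) := by
  have hy : (InnerProductSpace.toDual ℝ Xh).symm (rieszMap Xh ⟨k y, hk y⟩) = ⟨k y, hk y⟩ :=
    (InnerProductSpace.toDual ℝ Xh).symm_apply_apply _
  rw [transposeRieszForm, galerkin_rieszMap_comp k y (hk y), galerkin_rieszMap_comp k z (hk z), hy,
    real_inner_comm]
  rfl

/-- The matrix of `K' 𝓘_X⁻¹ K` is `Kᵀ M_X⁻¹ K`. -/
theorem transpose_mul_gram_inv_mul {V X : Type*} [AddCommMonoid V] [Module ℝ V]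
    [NormedAddCommGroup X] [InnerProductSpace ℝ X] [CompleteSpace X] {ι κ : Type*} [Fintype κ]
    [DecidableEq κ] (K : V →ₗ[ℝ] StrongDual ℝ X) (b : Module.Basis ι ℝ V) (c : Module.Basis κ ℝ X) :
    (operatorMatrix K b c).transpose * (Matrix.gram ℝ c)⁻¹ * operatorMatrix K b c =
      formMatrix (transposeRieszForm K) b := by
  let u : ι → X := fun j => (InnerProductSpace.toDual ℝ X).symm (K (b j))
  let C : Matrix κ ι ℝ := Matrix.of fun k j => c.repr (u j) k
  have hu : ∀ j, ∑ k, C k j • c k = u j := fun j => c.sum_repr (u j)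
  have hdet : IsUnit (Matrix.gram ℝ c).det :=
    isUnit_iff_ne_zero.2 (Matrix.det_gram_ne_zero_iff_linearIndependent.2 c.linearIndependent)
  have hK : operatorMatrix K b c = Matrix.gram ℝ c * C := by
    ext i j
    have h1 : K (b j) (c i) = inner ℝ (c i) (u j) := by
      rw [real_inner_comm]
      exact (InnerProductSpace.toDual_symm_apply).symm
    rw [operatorMatrix, Matrix.of_apply, h1, ← hu j, inner_sum, Matrix.mul_apply]
    exact Finset.sum_congr rfl fun k _ => by
      rw [real_inner_smul_right, Matrix.gram_apply, mul_comm]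
  rw [Matrix.mul_assoc]
  nth_rewrite 2 [hK]
  rw [Matrix.nonsing_inv_mul_cancel_left _ _ hdet]
  ext i j
  have h2 : transposeRieszForm K (b j) (b i) = K (b i) (u j) := rfl
  rw [formMatrix, Matrix.of_apply, h2, ← hu j, map_sum, Matrix.mul_apply]
  exact Finset.sum_congr rfl fun k _ => by
    rw [map_smul, smul_eq_mul, mul_comm]
    rfl

end Galerkin

/-- The derivative of a function with values in a closed subspace lies in that subspace. -/
theorem _root_.HasDerivWithinAt.mem_of_forall_mem {E : Type*} [NormedAddCommGroup E]
    [NormedSpace ℝ E] {S : Submodule ℝ E} (hS : IsClosed (S : Set E)) {f : ℝ → E} {f' : E}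
    {s : Set ℝ} {x : ℝ} (hx : x ∈ s) (hs : UniqueDiffWithinAt ℝ s x)
    (h : HasDerivWithinAt f f' s x) (hf : ∀ t ∈ s, f t ∈ S) : f' ∈ S := by
  have : (𝓝[s \ {x}] x).NeBot :=
    accPt_principal_iff_nhdsWithin.1 hs.accPt
  refine hS.mem_of_tendsto (hasDerivWithinAt_iff_tendsto_slope.1 h) ?_
  filter_upwards [self_mem_nhdsWithin] with t ht
  exact S.smul_mem _ (S.sub_mem (hf t ht.1) (hf x hx))

section Tensor

variable {Q : Cylinder N} {Yt : Submodule ℝ (Icc (0 : ℝ) Q.T → ℝ)} {Yx : Submodule ℝ (H10 Q)}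

theorem apply_mem_of_mem_tensorSpace {w : Icc (0 : ℝ) Q.T → H10 Q}
    (hw : w ∈ tensorSpace Q Yt Yx) (t : Icc (0 : ℝ) Q.T) : w t ∈ Yx := by
  have : tensorSpace Q Yt Yx ≤ Yx.comap (LinearMap.proj t) := by
    refine Submodule.span_le.2 ?_
    rintro _ ⟨θ, -, v, hv, rfl⟩
    exact Yx.smul_mem (θ t) hv
  exact this hw

theorem init_mem_of_toFun_mem_tensorSpace {y : Y Q} (hy : Y.toFun y ∈ tensorSpace Q Yt Yx) :
    Y.init y ∈ Yx :=
  apply_mem_of_mem_tensorSpace hy _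

theorem dtInit_mem_of_toFun_mem_tensorSpace {y : Y Q} (hy : Y.toFun y ∈ tensorSpace Q Yt Yx)
    {S : Submodule ℝ (L2Ω Q)} (hS : IsClosed (S : Set (L2Ω Q))) (hYx : Yx.map H10.toL2 ≤ S) :
    Y.dtInit y ∈ S := by
  have h0 : (0 : ℝ) ∈ Icc 0 Q.T := ⟨le_rfl, Q.T_pos.le⟩
  exact (y.2.1 ⟨0, h0⟩).mem_of_forall_mem hS h0 (uniqueDiffOn_Icc Q.T_pos _ h0)
    fun t _ => hYx ⟨_, apply_mem_of_mem_tensorSpace hy _, rfl⟩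

end Tensor

theorem conditionK1_iff {Q : Cylinder N} {normY : Seminorm ℝ (Y Q)} {cK : ℝ} :
    ConditionK1 Q normY cK ↔ 0 < cK ∧ ∀ y, normY y ≤ cK * Y.canonicalNorm Q y := by
  have h : ∀ y : Y Q, √(‖KU Q y‖ ^ 2 + (‖KR1 Q y‖ ^ 2 + ‖KR2 Q y‖ ^ 2)) =
      Y.canonicalNorm Q y := fun y => by
    simp only [Y.canonicalNorm_apply, KU, KR1, KR2, LinearMap.comp_apply, norm_rieszMap, add_assoc]
  simp only [ConditionK1, h]

namespace Discretization

variable {Q : Cylinder N} {D : Discretization Q}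

theorem conditionK1_iff (hU : ∀ y : D.Yh, Y.wave (y : Y Q) ∈ D.Uh)
    (h1 : ∀ y : D.Yh, Y.init (y : Y Q) ∈ D.R1h) (h2 : ∀ y : D.Yh, Y.dtInit (y : Y Q) ∈ D.R2h)
    {normY : Seminorm ℝ (Y Q)} {cK : ℝ} :
    D.ConditionK1 normY cK ↔
      0 < cK ∧ ∀ y : D.Yh, normY (y : Y Q) ≤ cK * Y.canonicalNorm Q y := by
  have h : ∀ y : D.Yh, √(‖D.KUh y‖ ^ 2 + (‖D.KR1h y‖ ^ 2 + ‖D.KR2h y‖ ^ 2)) =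
      Y.canonicalNorm Q y := fun y => by
    have eU : ‖D.KUh y‖ = ‖Y.wave (y : Y Q)‖ := norm_galerkin_rieszMap_comp Y.wave y (hU y)
    have e1 : ‖D.KR1h y‖ = ‖Y.init (y : Y Q)‖ := norm_galerkin_rieszMap_comp Y.init y (h1 y)
    have e2 : ‖D.KR2h y‖ = ‖Y.dtInit (y : Y Q)‖ := norm_galerkin_rieszMap_comp Y.dtInit y (h2 y)
    rw [Y.canonicalNorm_apply, eU, e1, e2, add_assoc]
  simp only [Discretization.ConditionK1, h]

theorem theoreticalBlock_eq_sparseBlock (hU : ∀ y : D.Yh, Y.wave (y : Y Q) ∈ D.Uh)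
    (h1 : ∀ y : D.Yh, Y.init (y : Y Q) ∈ D.R1h) (h2 : ∀ y : D.Yh, Y.dtInit (y : Y Q) ∈ D.R2h)
    (ω₀ : Set (EuclideanSpace ℝ (Fin N))) (α : ℝ) :
    D.theoreticalBlock ω₀ α = D.sparseBlock ω₀ α := by
  ext y z
  have eU : transposeRieszForm D.KUh y z = _ := transposeRieszForm_galerkin Y.wave hU y z
  have e1 : transposeRieszForm D.KR1h y z = _ := transposeRieszForm_galerkin Y.init h1 y z
  have e2 : transposeRieszForm D.KR2h y z = _ := transposeRieszForm_galerkin Y.dtInit h2 y z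
  rw [theoreticalBlock, sparseBlock, eU, e1, e2, H10.inner_def]

theorem theoreticalMatrix_eq_formMatrix (ω₀ : Set (EuclideanSpace ℝ (Fin N))) (α : ℝ)
    {ιY ιU ι1 ι2 : Type*} [Fintype ιU] [Fintype ι1] [Fintype ι2]
    [DecidableEq ιU] [DecidableEq ι1] [DecidableEq ι2] (bY : Module.Basis ιY ℝ D.Yh)
    (bU : Module.Basis ιU ℝ D.Uh) (b1 : Module.Basis ι1 ℝ D.R1h) (b2 : Module.Basis ι2 ℝ D.R2h) :
    D.theoreticalMatrix ω₀ α bY bU b1 b2 = formMatrix (D.theoreticalBlock ω₀ α) bY := by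
  have eU := transpose_mul_gram_inv_mul D.KUh bY bU
  have e1 := transpose_mul_gram_inv_mul D.KR1h bY b1
  have e2 := transpose_mul_gram_inv_mul D.KR2h bY b2
  rw [theoreticalMatrix, eU, e1, e2]
  rfl

end Discretization

end WaveControl

theorem lemma5p1 {N : ℕ} (Q : Cylinder N)
    (ω₀ : Set (EuclideanSpace ℝ (Fin N))) (hω : IsOpen ω₀) (hωΩ : ω₀ ⊆ Q.Ω)
    (D : Discretization Q)
    -- `Y_h = Y_h^t ⊗ Y_h^x`
    (Yt : Submodule ℝ (Set.Icc (0 : ℝ) Q.T → ℝ)) (Yx : Submodule ℝ (H10 Q))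
    (htensor : D.Yh.map Y.toFun = tensorSpace Q Yt Yx)
    -- `(∂_tt − Δ) Y_h ⊆ U_h`, `Y_h^x ⊆ R_{1,h}`, `Y_h^x ⊆ R_{2,h}`
    (hU : D.Yh.map Y.wave ≤ D.Uh) (hR1 : Yx ≤ D.R1h) (hR2 : Yx.map H10.toL2 ≤ D.R2h) :
    -- `P̃_{Y_h} = P_{Y_h}` as forms on `Y_h`, and as matrices relative to arbitrary bases
    (∀ α : ℝ, 0 < α →
      D.theoreticalBlock ω₀ α = D.sparseBlock ω₀ α ∧
      ∀ {ιY ιU ι1 ι2 : Type*} [Fintype ιY] [Fintype ιU] [Fintype ι1] [Fintype ι2]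
        [DecidableEq ιU] [DecidableEq ι1] [DecidableEq ι2]
        (bY : Module.Basis ιY ℝ D.Yh) (bU : Module.Basis ιU ℝ D.Uh)
        (b1 : Module.Basis ι1 ℝ D.R1h) (b2 : Module.Basis ι2 ℝ D.R2h),
        D.theoreticalMatrix ω₀ α bY bU b1 b2 = D.sparseMatrix ω₀ α bY) ∧
    -- (K1) carries over to the discrete state operator with the same constant
    (∀ (normY : Seminorm ℝ (Y Q)) (cK : ℝ),
      ConditionK1 Q normY cK → D.ConditionK1 normY cK) ∧
    -- for the canonical norm of `Y`, (K1) holds for both operators with constant one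
    ConditionK1 Q (Y.canonicalNorm Q) 1 ∧ D.ConditionK1 (Y.canonicalNorm Q) 1 := by
  have mem {y : Y Q} (hy : y ∈ D.Yh) : Y.toFun y ∈ tensorSpace Q Yt Yx :=
    htensor ▸ Submodule.mem_map_of_mem hy
  have hU' : ∀ y : D.Yh, Y.wave (y : Y Q) ∈ D.Uh := fun y => hU ⟨y, y.2, rfl⟩
  have h1 : ∀ y : D.Yh, Y.init (y : Y Q) ∈ D.R1h := fun y =>
    hR1 (init_mem_of_toFun_mem_tensorSpace (mem y.2))
  have h2 : ∀ y : D.Yh, Y.dtInit (y : Y Q) ∈ D.R2h := fun y =>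
    dtInit_mem_of_toFun_mem_tensorSpace (mem y.2) D.R2h.closed_of_finiteDimensional hR2
  have hK : ∀ (normY : Seminorm ℝ (Y Q)) (cK : ℝ),
      ConditionK1 Q normY cK → D.ConditionK1 normY cK := fun normY cK h =>
    have h' := conditionK1_iff.1 h
    (Discretization.conditionK1_iff hU' h1 h2).2 ⟨h'.1, fun y => h'.2 y⟩
  have hcan : ConditionK1 Q (Y.canonicalNorm Q) 1 :=
    conditionK1_iff.2 ⟨one_pos, fun y => (one_mul _).ge⟩
  refine ⟨fun α _ => ?_, hK, hcan, hK _ _ hcan⟩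
  have hblock := Discretization.theoreticalBlock_eq_sparseBlock hU' h1 h2 ω₀ α
  refine ⟨hblock, fun bY bU b1 b2 => ?_⟩
  rw [Discretization.theoreticalMatrix_eq_formMatrix, hblock, Discretization.sparseMatrix]
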